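/- Let $G$ be a finite simple connected nonbipartite graph of order $n\ge 6$ whose domination number (the minimum cardinality of a set $D$ of vertices such that every vertex outside $D$ is adjacent to a vertex of $D$) equals $n/2$; in particular $n$ is even. For a graph $F$, let $q_{\min}(F)$ denote the least eigenvalue of the signless Laplacian matrix $Q(F)=D(F)+A(F)$, where $D(F)$ is the diagonal matrix of vertex degrees and $A(F)$ is the adjacency matrix. Let $\mathscr{H}_{3,n/2}$ be the graph of order $n$ with vertices $v_1,\dots,v_{n/2},w_1,\dots,w_{n/2}$ and edges $v_iv_{i+1}$ $(1\le i<n/2)$, $v_1v_3$, and $v_iw_i$ $(1\le i\le n/2)$; that is, a triangle $v_1v_2v_3$ with a path $v_3v_4\cdots v_{n/2}$ attached at $v_3$, together with one pendant vertex attached at each of $v_1,\dots,v_{n/2}$. Then $$q_{\min}(G)\ \ge\ q_{\min}(\mathscr{H}_{3,n/2}),$$ with equality if and only if $G\cong\mathscr{H}_{3,n/2}$. -/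

import Mathlib

namespace SimpleGraph

/-- `D` is a dominating set of `G`: every vertex outside `D` is adjacent to a vertex of `D`. -/
def IsDominatingSet {V : Type*} (G : SimpleGraph V) (D : Finset V) : Prop :=
  ∀ v, v ∉ D → ∃ u ∈ D, G.Adj u v

/-- The domination number of a finite graph: the minimum cardinality of its dominating sets
(the set of cardinalities is nonempty, since the set of all vertices is dominating). -/
noncomputable def dominationNumber {V : Type*} [Fintype V] (G : SimpleGraph V) : ℕ :=
  sInf {k : ℕ | ∃ D : Finset V, G.IsDominatingSet D ∧ D.card = k}

/-- The signless Laplacian `Q(G) = D(G) + A(G)`: degree matrix plus adjacency matrix. -/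
def signlessLaplacian {V : Type*} [Fintype V] [DecidableEq V] (G : SimpleGraph V)
    [DecidableRel G.Adj] : Matrix V V ℝ :=
  G.degMatrix ℝ + G.adjMatrix ℝ

/-- The least eigenvalue of the signless Laplacian. For a nonempty vertex set, the set of
eigenvalues is finite and nonempty (the matrix is real symmetric), so the infimum is attained. -/
noncomputable def qMin {V : Type*} [Fintype V] [DecidableEq V] (G : SimpleGraph V)
    [DecidableRel G.Adj] : ℝ :=
  sInf {q : ℝ | Module.End.HasEigenvalue (Matrix.toLin' G.signlessLaplacian) q}

/-- The corona of `G` and `H`: one copy of `G` and, for each vertex `v` of `G`, a copy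
`{(v, w) | w : W}` of `H`, all of whose vertices are joined to `v`. -/
def corona {V W : Type*} (G : SimpleGraph V) (H : SimpleGraph W) : SimpleGraph (V ⊕ V × W) where
  Adj
    | .inl u, .inl v => G.Adj u v
    | .inl u, .inr q => u = q.1
    | .inr p, .inl v => p.1 = v
    | .inr p, .inr q => p.1 = q.1 ∧ H.Adj p.2 q.2
  symm := by
    constructor
    rintro (u | p) (v | q) h
    · exact SimpleGraph.Adj.symm h
    · exact Eq.symm h
    · exact Eq.symm h
    · exact ⟨h.1.symm, SimpleGraph.Adj.symm h.2⟩
  loopless := by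
    constructor
    rintro (u | p) h
    · exact G.loopless.irrefl u h
    · exact H.loopless.irrefl p.2 h.2

/-- The lollipop graph with `m` vertices in total (`3 ≤ g ≤ m`), numbered `0, …, m - 1`: the cycle
`0, 1, …, g - 1` together with the path `g - 1, g, …, m - 1` attached at the vertex `g - 1`.
For `m = g` it is the cycle itself. -/
def lollipop (g m : ℕ) : SimpleGraph (Fin m) :=
  fromRel fun i j => (j : ℕ) = i + 1 ∨ ((i : ℕ) = 0 ∧ (j : ℕ) + 1 = g)

/-- The graph of order `2 * m` obtained from a triangle with a pendant path, `m ≥ 3` vertices in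
total, by attaching one pendant vertex at every vertex. -/
abbrev lollipopCorona (m : ℕ) : SimpleGraph (Fin m ⊕ Fin m × Unit) :=
  (lollipop 3 m).corona (⊤ : SimpleGraph Unit)

instance {V W : Type*} [DecidableEq V] (G : SimpleGraph V) (H : SimpleGraph W)
    [DecidableRel G.Adj] [DecidableRel H.Adj] : DecidableRel (G.corona H).Adj
  | .inl u, .inl v => inferInstanceAs (Decidable (G.Adj u v))
  | .inl u, .inr q => inferInstanceAs (Decidable (u = q.1))
  | .inr p, .inl v => inferInstanceAs (Decidable (p.1 = v))
  | .inr p, .inr q => inferInstanceAs (Decidable (p.1 = q.1 ∧ H.Adj p.2 q.2))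

instance (g m : ℕ) : DecidableRel (lollipop g m).Adj := fun i j =>
  inferInstanceAs (Decidable (i ≠ j ∧
    (((j : ℕ) = i + 1 ∨ ((i : ℕ) = 0 ∧ (j : ℕ) + 1 = g)) ∨
      ((i : ℕ) = j + 1 ∨ ((j : ℕ) = 0 ∧ (i : ℕ) + 1 = g)))))

end SimpleGraph

/-! Domination number `n/2` forces `G` to be the corona of a connected nonbipartite graph `H` on `m
= n/2` vertices (`exists_iso_corona`). Indeed a minimum dominating set with external private
neighbours is perfectly matched to its complement, and one end of each matched pair is a leaf:
otherwise the set could be shrunk, or `G` would have at most four vertices.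

The least eigenvalue is the minimum of the Rayleigh quotient of `∑ (x u + x v) ^ 2` over edges. From
a minimizer on `G` keep the absolute values, choose signs on `H` so that the edges with ends of
opposite signs still connect `H`, and number its vertices so that the absolute values `a 0 ≤ a 1 ≤
…` increase. An edge `uv` then costs `(a v - a u) ^ 2` or `(a u + a v) ^ 2`, according to the signs.
Opposite-sign edges cross every gap between `k` and `k + 1`, and some edge has equal signs because
`H` is not bipartite. Whether or not that edge is `01`, the total is at least the form of the
triangle with a pendant path at the same values (`lollipopForm_le_signlessForm`). Pendant edges cost
at least `(|x w| - |z w|) ^ 2`, so the inequality follows.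

In case of equality the rearranged vector is itself a minimizer. For `m ≥ 4` its Euler equations
make `a` positive and strictly increasing from index 1 on (`rigid_of_minimizer`), and then any other
edge set is strictly more expensive. For `m = 3` the base can only be a triangle. -/

namespace SimpleGraph

open Finset Matrix

/-! ### Adjacency and isomorphisms of coronas -/

section Corona

variable {V W : Type*}

theorem corona_adj_inl_inl {X : Type*} (H : SimpleGraph W) (K : SimpleGraph X) (u v : W) :
    (H.corona K).Adj (.inl u) (.inl v) ↔ H.Adj u v := Iff.rfl

theorem corona_adj_inl_inr {X : Type*} (H : SimpleGraph W) (K : SimpleGraph X) (u : W)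
    (q : W × X) : (H.corona K).Adj (.inl u) (.inr q) ↔ u = q.1 := Iff.rfl

theorem corona_adj_inr_inl {X : Type*} (H : SimpleGraph W) (K : SimpleGraph X) (u : W)
    (q : W × X) : (H.corona K).Adj (.inr q) (.inl u) ↔ u = q.1 := eq_comm

theorem corona_adj_inr_inr {X : Type*} (H : SimpleGraph W) (K : SimpleGraph X)
    (p q : W × X) : (H.corona K).Adj (.inr p) (.inr q) ↔ p.1 = q.1 ∧ K.Adj p.2 q.2 := Iff.rfl

/-- The isomorphism of coronas induced by an isomorphism of the base graphs. -/
def coronaIso {G : SimpleGraph V} {H : SimpleGraph W} (φ : G ≃g H) :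
    G.corona (⊤ : SimpleGraph Unit) ≃g H.corona (⊤ : SimpleGraph Unit) where
  toEquiv := Equiv.sumCongr φ.toEquiv (Equiv.prodCongr φ.toEquiv (Equiv.refl Unit))
  map_rel_iff' := by
    rintro (u | ⟨u, _⟩) (v | ⟨v, _⟩) <;>
      simp [corona_adj_inl_inl, corona_adj_inl_inr, corona_adj_inr_inl, corona_adj_inr_inr,
        φ.map_adj_iff]

end Corona

/-! ### The signless quadratic form and the Rayleigh principle -/

section QuadraticForm

variable {V W : Type*} [Fintype V] [Fintype W]

open Classical in
/-- The quadratic form of the signless Laplacian: the sum of `(x u + x v) ^ 2` over all edges. -/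
noncomputable def signlessForm (G : SimpleGraph V) (x : V → ℝ) : ℝ :=
  (∑ u, ∑ v, if G.Adj u v then (x u + x v) ^ 2 else 0) / 2

theorem dotProduct_signlessLaplacian_mulVec [DecidableEq V] (G : SimpleGraph V)
    [DecidableRel G.Adj] (x : V → ℝ) :
    x ⬝ᵥ (G.signlessLaplacian *ᵥ x) = G.signlessForm x := by
  have h : G.signlessForm x =
      (∑ u, ∑ v, if G.Adj u v then (x u + x v) ^ 2 else 0) / 2 := by
    unfold signlessForm
    congr! 6
  rw [h]
  simp_rw [signlessLaplacian, add_mulVec, dotProduct_add, dotProduct_mulVec_degMatrix,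
    dotProduct_mulVec_adjMatrix, ← sum_add_distrib, degree_eq_sum_if_adj, sum_mul, ite_mul,
    one_mul, zero_mul, ← sum_add_distrib, ite_add_ite, add_zero]
  rw [← add_self_div_two (∑ x_1 : V, ∑ x_2 : V, _)]
  conv_lhs => enter [1, 2, 2, i, 2, j]; rw [if_congr (adj_comm G i j) rfl rfl]
  conv_lhs => enter [1, 2]; rw [Finset.sum_comm]
  simp_rw [← sum_add_distrib, ite_add_ite]
  congr 2 with i
  congr 2 with j
  ring_nf

theorem isHermitian_signlessLaplacian [DecidableEq V] (G : SimpleGraph V) [DecidableRel G.Adj] :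
    G.signlessLaplacian.IsHermitian :=
  (G.isHermitian_degMatrix ℝ).add (G.isHermitian_adjMatrix ℝ)

theorem hasEigenvalue_toLin'_iff [DecidableEq V] (M : Matrix V V ℝ) (q : ℝ) :
    Module.End.HasEigenvalue (Matrix.toLin' M) q ↔ q ∈ spectrum ℝ M := by
  rw [Module.End.hasEigenvalue_iff_mem_spectrum, Matrix.spectrum_toLin']

theorem qMin_mem_spectrum [DecidableEq V] [Nonempty V] (G : SimpleGraph V) [DecidableRel G.Adj] :
    G.qMin ∈ spectrum ℝ G.signlessLaplacian := by
  have h : {q : ℝ | Module.End.HasEigenvalue (Matrix.toLin' G.signlessLaplacian) q} =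
      spectrum ℝ G.signlessLaplacian := by
    ext q
    exact hasEigenvalue_toLin'_iff _ q
  unfold qMin
  rw [h]
  refine Set.Nonempty.csInf_mem ?_ Matrix.finite_real_spectrum
  exact ⟨_, G.isHermitian_signlessLaplacian.eigenvalues_mem_spectrum_real (Classical.arbitrary V)⟩

theorem qMin_le_of_mem_spectrum [DecidableEq V] (G : SimpleGraph V) [DecidableRel G.Adj] {q : ℝ}
    (hq : q ∈ spectrum ℝ G.signlessLaplacian) : G.qMin ≤ q := by
  have h : {q : ℝ | Module.End.HasEigenvalue (Matrix.toLin' G.signlessLaplacian) q} =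
      spectrum ℝ G.signlessLaplacian := by
    ext q
    exact hasEigenvalue_toLin'_iff _ q
  unfold qMin
  rw [h]
  exact csInf_le Matrix.finite_real_spectrum.bddBelow hq

theorem exists_signlessForm_eq [DecidableEq V] [Nonempty V] (G : SimpleGraph V)
    [DecidableRel G.Adj] :
    ∃ x : V → ℝ, x ≠ 0 ∧ G.signlessForm x = G.qMin * ∑ v, x v ^ 2 := by
  obtain ⟨x, hx⟩ := ((hasEigenvalue_toLin'_iff _ _).2 G.qMin_mem_spectrum).exists_hasEigenvector
  refine ⟨x, hx.2, ?_⟩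
  have h : G.signlessLaplacian *ᵥ x = G.qMin • x := by
    simpa using hx.apply_eq_smul
  rw [← dotProduct_signlessLaplacian_mulVec, h, dotProduct_smul, smul_eq_mul]
  simp [dotProduct, sq]

/-- Subtracting `qMin` from the diagonal shifts the spectrum into the nonnegative reals, so the
resulting Hermitian matrix is positive semidefinite. -/
theorem qMin_mul_le [DecidableEq V] (G : SimpleGraph V) [DecidableRel G.Adj] (x : V → ℝ) :
    G.qMin * ∑ v, x v ^ 2 ≤ G.signlessForm x := by
  have hH : (G.signlessLaplacian - algebraMap ℝ (Matrix V V ℝ) G.qMin).IsHermitian := by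
    refine G.isHermitian_signlessLaplacian.sub ?_
    rw [Algebra.algebraMap_eq_smul_one]
    simp [IsHermitian]
  have hP : (G.signlessLaplacian - algebraMap ℝ (Matrix V V ℝ) G.qMin).PosSemidef := by
    rw [Matrix.posSemidef_iff_isHermitian_and_spectrum_nonneg]
    refine ⟨hH, fun t ht => ?_⟩
    rw [← spectrum.sub_singleton_eq] at ht
    obtain ⟨q, hq, r, rfl, rfl⟩ := ht
    simpa using G.qMin_le_of_mem_spectrum hq
  have h := hP.dotProduct_mulVec_nonneg x
  rw [sub_mulVec, dotProduct_sub, star_trivial, dotProduct_signlessLaplacian_mulVec,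
    Algebra.algebraMap_eq_smul_one, smul_mulVec, one_mulVec, dotProduct_smul, smul_eq_mul] at h
  have e : x ⬝ᵥ x = ∑ v, x v ^ 2 := by simp [dotProduct, sq]
  rw [e] at h
  linarith

theorem signlessForm_comp_iso {G : SimpleGraph V} {H : SimpleGraph W} (φ : G ≃g H) (x : W → ℝ) :
    G.signlessForm (x ∘ φ) = H.signlessForm x := by
  unfold signlessForm
  congr 1
  rw [← Equiv.sum_comp φ.toEquiv]
  refine sum_congr rfl fun u _ => ?_
  rw [← Equiv.sum_comp φ.toEquiv]
  classical exact sum_congr rfl fun v _ => if_congr φ.map_adj_iff.symm rfl rfl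

theorem qMin_le_qMin_of_iso [DecidableEq V] [DecidableEq W] [Nonempty W] {G : SimpleGraph V}
    {H : SimpleGraph W} [DecidableRel G.Adj] [DecidableRel H.Adj] (φ : G ≃g H) :
    G.qMin ≤ H.qMin := by
  obtain ⟨x, hx0, hx⟩ := H.exists_signlessForm_eq
  have h := G.qMin_mul_le (x ∘ φ)
  rw [signlessForm_comp_iso, hx] at h
  have e : ∑ v, (x ∘ φ) v ^ 2 = ∑ w, x w ^ 2 := Equiv.sum_comp φ.toEquiv fun w => x w ^ 2
  rw [e] at h
  refine le_of_mul_le_mul_right h ?_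
  obtain ⟨w, hw⟩ := Function.ne_iff.1 hx0
  exact sum_pos' (fun _ _ => sq_nonneg _) ⟨w, mem_univ _, sq_pos_iff.2 hw⟩

theorem qMin_eq_of_iso [DecidableEq V] [DecidableEq W] [Nonempty V] [Nonempty W]
    {G : SimpleGraph V} {H : SimpleGraph W} [DecidableRel G.Adj] [DecidableRel H.Adj]
    (φ : G ≃g H) : G.qMin = H.qMin :=
  le_antisymm (qMin_le_qMin_of_iso φ) (qMin_le_qMin_of_iso φ.symm)

theorem signlessForm_corona (H : SimpleGraph W) (x : W ⊕ W × Unit → ℝ) :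
    (H.corona (⊤ : SimpleGraph Unit)).signlessForm x =
      H.signlessForm (fun w => x (.inl w)) + ∑ w, (x (.inl w) + x (.inr (w, ()))) ^ 2 := by
  classical
  unfold signlessForm
  simp only [Fintype.sum_sum_type, Fintype.sum_prod_type, corona_adj_inl_inl, corona_adj_inl_inr,
    corona_adj_inr_inl, corona_adj_inr_inr, univ_unique, sum_singleton, sum_add_distrib]
  simp only [top_adj, ne_eq, not_true_eq_false, and_false, if_false, sum_const_zero, add_zero,
    Finset.sum_ite_eq, Finset.sum_ite_eq', mem_univ, if_true, PUnit.default_eq_unit]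
  simp only [add_comm (x (.inr _)) (x (.inl _))]
  ring

end QuadraticForm

/-! ### Choice of signs -/

section Signs

variable {V : Type*}

/-- Every partition of the vertex set into two nonempty parts is crossed by an edge of `G`. -/
def CrossesCuts (G : SimpleGraph V) : Prop :=
  ∀ S : Set V, S.Nonempty → Sᶜ.Nonempty → ∃ u ∈ S, ∃ v ∉ S, G.Adj u v

theorem Connected.crossesCuts {G : SimpleGraph V} (h : G.Connected) : G.CrossesCuts := by
  rintro S ⟨u, hu⟩ ⟨v, hv⟩
  obtain ⟨p⟩ := h.preconnected u v
  obtain ⟨d, -, h1, h2⟩ := p.exists_boundary_dart S hu hv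
  exact ⟨_, h1, _, h2, d.adj⟩

/-- The spanning subgraph of the edges of `G` between vertices of different signs. -/
def cutGraph (G : SimpleGraph V) (ε : V → ℤˣ) : SimpleGraph V where
  Adj u v := G.Adj u v ∧ ε u ≠ ε v
  symm := ⟨fun _ _ h => ⟨h.1.symm, h.2.symm⟩⟩
  loopless := ⟨fun _ h => h.2 rfl⟩

theorem cast_units_sq (e : ℤˣ) : ((e : ℤ) : ℝ) ^ 2 = 1 := by
  rcases Int.units_eq_one_or e with rfl | rfl <;> simp

variable [Fintype V]

/-- Changing the signs of the entries of a vector, one can make all cuts be crossed by edges with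
ends of different signs without increasing the quadratic form. -/
theorem CrossesCuts.exists_signs {G : SimpleGraph V} (hG : G.CrossesCuts) (x : V → ℝ) :
    ∃ ε : V → ℤˣ, (G.cutGraph ε).CrossesCuts ∧
      G.signlessForm (fun v => ((ε v : ℤ) : ℝ) * |x v|) ≤ G.signlessForm x := by
  classical
  let A : Finset (V → ℤˣ) := univ.filter fun ε =>
    G.signlessForm (fun v => ((ε v : ℤ) : ℝ) * |x v|) ≤ G.signlessForm x
  let c : (V → ℤˣ) → Finset (V × V) := fun ε =>
    univ.filter fun p => G.Adj p.1 p.2 ∧ ε p.1 ≠ ε p.2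
  have hA : A.Nonempty := by
    refine ⟨fun v => if 0 ≤ x v then 1 else -1, ?_⟩
    rw [mem_filter]
    refine ⟨mem_univ _, le_of_eq ?_⟩
    congr 1
    ext v
    by_cases h : 0 ≤ x v
    · simp [h, abs_of_nonneg h]
    · simp [h, abs_of_neg (not_le.1 h)]
  -- Take the most opposite-sign edges. If none crossed `S`, flipping the signs on `S` would turn
  -- the edges across `S` into opposite-sign ones, and the form would not grow since the absolute
  -- values are nonnegative.
  obtain ⟨ε, hε, hmax⟩ := exists_max_image A (fun ε => (c ε).card) hA
  have hle := (mem_filter.1 hε).2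
  refine ⟨ε, ?_, hle⟩
  intro S hS hS'
  by_contra! hno
  have hsame : ∀ u ∈ S, ∀ v ∉ S, G.Adj u v → ε u = ε v := by
    intro u hu v hv huv
    by_contra hne
    exact hno u hu v hv ⟨huv, hne⟩
  let δ : V → ℤˣ := fun v => if v ∈ S then -ε v else ε v
  have hin : ∀ v ∈ S, δ v = -ε v := fun v hv => if_pos hv
  have hout : ∀ v ∉ S, δ v = ε v := fun v hv => if_neg hv
  have key : ∀ (e : ℤˣ) (a b : V), (-((e : ℤ) : ℝ) * |x a| + ((e : ℤ) : ℝ) * |x b|) ^ 2 ≤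
      (((e : ℤ) : ℝ) * |x a| + ((e : ℤ) : ℝ) * |x b|) ^ 2 := by
    intro e a b
    have h1 := cast_units_sq e
    have h2 : 0 ≤ |x a| * |x b| := by positivity
    have h3 : (((e : ℤ) : ℝ) * |x a| + ((e : ℤ) : ℝ) * |x b|) ^ 2 -
      (-((e : ℤ) : ℝ) * |x a| + ((e : ℤ) : ℝ) * |x b|) ^ 2 =
        4 * ((e : ℤ) : ℝ) ^ 2 * (|x a| * |x b|) := by ring
    rw [h1] at h3
    linarith
  have hδ : δ ∈ A := by
    refine mem_filter.2 ⟨mem_univ _, le_trans ?_ hle⟩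
    unfold signlessForm
    refine div_le_div_of_nonneg_right (sum_le_sum fun u _ => sum_le_sum fun v _ => ?_) two_pos.le
    by_cases huv : G.Adj u v
    · rw [if_pos huv, if_pos huv]
      beta_reduce
      by_cases hu : u ∈ S <;> by_cases hv : v ∈ S
      · rw [hin u hu, hin v hv]
        push_cast
        exact le_of_eq (by ring)
      · rw [hin u hu, hout v hv, hsame u hu v hv huv]
        push_cast
        exact key _ _ _
      · rw [hout u hu, hin v hv, hsame v hv u hu huv.symm]
        push_cast
        rw [add_comm, add_comm (_ * |x u|)]
        exact key _ _ _
      · rw [hout u hu, hout v hv]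
    · rw [if_neg huv, if_neg huv]
  refine absurd (hmax δ hδ) (not_le.2 (card_lt_card ?_))
  rw [Finset.ssubset_iff_of_subset]
  · obtain ⟨u, hu, v, hv, huv⟩ := hG S hS hS'
    refine ⟨(u, v), mem_filter.2 ⟨mem_univ _, huv, ?_⟩, ?_⟩
    · simp only
      rw [hin u hu, hout v hv, hsame u hu v hv huv]
      rcases Int.units_eq_one_or (ε v) with h | h <;> rw [h] <;> decide
    · intro h
      exact (mem_filter.1 h).2.2 (hsame u hu v hv huv)
  · intro p hp
    obtain ⟨-, hp1, hp2⟩ := mem_filter.1 hp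
    refine mem_filter.2 ⟨mem_univ _, hp1, ?_⟩
    by_cases hu : p.1 ∈ S <;> by_cases hv : p.2 ∈ S
    · rw [hin _ hu, hin _ hv]
      exact fun h => hp2 (neg_injective h)
    · exact absurd (hsame _ hu _ hv hp1) hp2
    · exact absurd (hsame _ hv _ hu hp1.symm).symm hp2
    · rwa [hout _ hu, hout _ hv]

/-- A graph that is not bipartite has an edge with ends of equal signs. -/
theorem exists_adj_eq_of_not_isBipartite {V : Type*} {G : SimpleGraph V} (hG : ¬ G.IsBipartite)
    (ε : V → ℤˣ) : ∃ u v, G.Adj u v ∧ ε u = ε v := by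
  by_contra! h
  refine hG ⟨Coloring.mk (fun v => if ε v = 1 then (0 : Fin 2) else 1) fun {u v} huv => ?_⟩
  have := h u v huv
  rcases Int.units_eq_one_or (ε u) with hu | hu <;> rcases Int.units_eq_one_or (ε v) with hv | hv <;>
    simp_all

end Signs

/-! ### Edges as increasing pairs -/

section LinearOrder

variable {V : Type*} [Fintype V] [LinearOrder V]

open Classical in
/-- The edges of `G`, as increasing pairs. -/
noncomputable def increasingEdges (G : SimpleGraph V) : Finset (V × V) :=
  univ.filter fun p => p.1 < p.2 ∧ G.Adj p.1 p.2

theorem mem_increasingEdges {G : SimpleGraph V} {p : V × V} :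
    p ∈ G.increasingEdges ↔ p.1 < p.2 ∧ G.Adj p.1 p.2 := by
  simp [increasingEdges]

theorem signlessForm_eq_sum_increasingEdges (G : SimpleGraph V) (x : V → ℝ) :
    G.signlessForm x = ∑ p ∈ G.increasingEdges, (x p.1 + x p.2) ^ 2 := by
  classical
  have h1 : ∑ p ∈ G.increasingEdges, (x p.1 + x p.2) ^ 2 =
      ∑ u, ∑ v, if u < v ∧ G.Adj u v then (x u + x v) ^ 2 else 0 := by
    rw [increasingEdges, sum_filter, Fintype.sum_prod_type]
  have h2 : ∑ p ∈ G.increasingEdges, (x p.1 + x p.2) ^ 2 =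
      ∑ u, ∑ v, if v < u ∧ G.Adj u v then (x u + x v) ^ 2 else 0 := by
    rw [h1, sum_comm]
    refine sum_congr rfl fun u _ => sum_congr rfl fun v _ => ?_
    rw [G.adj_comm, add_comm]
  unfold signlessForm
  rw [div_eq_iff two_ne_zero, mul_two]
  nth_rewrite 1 [h1]
  rw [h2, ← sum_add_distrib]
  refine sum_congr rfl fun u _ => ?_
  rw [← sum_add_distrib]
  refine sum_congr rfl fun v _ => ?_
  by_cases huv : G.Adj u v
  · rcases lt_trichotomy u v with h | h | h
    · simp [huv, h, h.not_gt]
    · exact absurd h huv.ne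
    · simp [huv, h, h.not_gt]
  · simp [huv]

end LinearOrder

/-! ### Lower bounds for the form at increasing absolute values -/

section Rearrangement

/-- The increments are nonnegative, so the square of their sum dominates the sum of their squares.
-/
theorem sum_Ico_sq_sub_le {a : ℕ → ℝ} (ha : Monotone a) {u v : ℕ} (huv : u ≤ v) :
    ∑ k ∈ Ico u v, (a (k + 1) - a k) ^ 2 ≤ (a v - a u) ^ 2 := by
  induction v, huv using Nat.le_induction with
  | base => simp
  | succ v h ih =>
    rw [sum_Ico_succ_top h]
    nlinarith [mul_nonneg (sub_nonneg.2 (ha h)) (sub_nonneg.2 (ha v.le_succ))]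

/-- The quadratic form of the triangle with a pendant path, as a function of the absolute values
of the entries of an eigenvector of its least eigenvalue. -/
def lollipopForm (m : ℕ) (a : ℕ → ℝ) : ℝ :=
  (a 0 + a 1) ^ 2 + (a 2 - a 0) ^ 2 + (a 2 - a 1) ^ 2 +
    ∑ k ∈ Ico 2 (m - 1), (a (k + 1) - a k) ^ 2

/-- Double counting: every gap from `c` on lies under at least one pair of `T`. The cutoff `c` is 2
when the equal-sign edge is `01`, and 0 otherwise. -/
theorem sum_Ico_le_sum_edges {m : ℕ} (T : Finset (Fin m × Fin m))
    (hT : ∀ k, k + 1 < m → ∃ p ∈ T, (p.1 : ℕ) ≤ k ∧ k < (p.2 : ℕ)) (c : ℕ) (s : ℕ → ℝ)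
    (hs : ∀ k, 0 ≤ s k) :
    ∑ k ∈ Ico c (m - 1), s k ≤ ∑ p ∈ T, ∑ k ∈ Ico (max (p.1 : ℕ) c) p.2, s k := by
  have h : ∀ p ∈ T, ∑ k ∈ Ico (max (p.1 : ℕ) c) p.2, s k =
      ∑ k ∈ Ico c (m - 1), if (p.1 : ℕ) ≤ k ∧ k < (p.2 : ℕ) then s k else 0 := by
    intro p _
    rw [← sum_filter]
    refine sum_congr ?_ fun _ _ => rfl
    ext k
    have := p.2.isLt
    simp only [mem_Ico, mem_filter, max_le_iff]
    omega
  rw [sum_congr rfl h, sum_comm]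
  refine sum_le_sum fun k hk => ?_
  obtain ⟨p, hp, hp1⟩ := hT k (by rw [mem_Ico] at hk; omega)
  refine le_trans (le_of_eq (if_pos hp1).symm)
    (single_le_sum (f := fun q : Fin m × Fin m =>
      if (q.1 : ℕ) ≤ k ∧ k < (q.2 : ℕ) then s k else 0) (fun q _ => ?_) hp)
  split_ifs
  exacts [hs k, le_rfl]

variable {m : ℕ} {H : SimpleGraph (Fin m)} {ε : Fin m → ℤˣ} {a : ℕ → ℝ}

theorem CrossesCuts.exists_increasingEdges (hH : H.CrossesCuts) (k : ℕ) (hk : k + 1 < m) :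
    ∃ p ∈ H.increasingEdges, (p.1 : ℕ) ≤ k ∧ k < (p.2 : ℕ) := by
  obtain ⟨u, hu, v, hv, huv⟩ := hH {i | (i : ℕ) ≤ k} ⟨⟨k, by omega⟩, by simp⟩
    ⟨⟨k + 1, hk⟩, by simp⟩
  simp only [Set.mem_ofPred_eq, not_le] at hu hv
  exact ⟨(u, v), mem_increasingEdges.2 ⟨Fin.lt_def.2 (by simp only; omega), huv⟩, hu, hv⟩

theorem CrossesCuts.exists_adj (hH : H.CrossesCuts) (hm : 2 ≤ m) (i : Fin m) :
    ∃ j, H.Adj i j := by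
  have hi : ∃ j : Fin m, j ≠ i := by
    by_cases h : (i : ℕ) = 0
    · exact ⟨⟨1, by omega⟩, fun h' => by simp [← h'] at h⟩
    · exact ⟨⟨0, by omega⟩, fun h' => by simp [← h'] at h⟩
  obtain ⟨u, hu, v, -, huv⟩ := hH {i} ⟨i, rfl⟩ hi
  rw [Set.mem_singleton_iff] at hu
  exact ⟨v, hu ▸ huv⟩

theorem signlessForm_split (H : SimpleGraph (Fin m)) (ε : Fin m → ℤˣ) (a : ℕ → ℝ) :
    H.signlessForm (fun i => ((ε i : ℤ) : ℝ) * a i) =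
      ∑ p ∈ (H.cutGraph ε).increasingEdges, (a p.2 - a p.1) ^ 2 +
      ∑ p ∈ H.increasingEdges with ε p.1 = ε p.2, (a p.1 + a p.2) ^ 2 := by
  rw [signlessForm_eq_sum_increasingEdges,
    ← sum_filter_add_sum_filter_not _ (fun p => ε p.1 = ε p.2), add_comm]
  congr 1
  · have h : (H.cutGraph ε).increasingEdges =
        H.increasingEdges.filter fun p => ¬ ε p.1 = ε p.2 := by
      ext p
      rw [mem_filter, mem_increasingEdges, mem_increasingEdges]
      simp only [cutGraph]
      tauto
    rw [h]
    refine sum_congr rfl fun p hp => ?_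
    have h2 := Int.units_ne_iff_eq_neg.1 (mem_filter.1 hp).2
    rw [h2]
    push_cast
    have := cast_units_sq (ε p.2)
    calc _ = (((ε p.2 : ℤ) : ℝ)) ^ 2 * (a p.2 - a p.1) ^ 2 := by ring
      _ = _ := by rw [this, one_mul]
  · refine sum_congr rfl fun p hp => ?_
    rw [(mem_filter.1 hp).2, ← mul_add, mul_pow, cast_units_sq, one_mul]

/-- The part of the contribution of an edge with ends `u < v` of different signs that is needed
when the vertices `0` and `1` are joined by an edge and have equal signs. -/
def edgeWeight (a : ℕ → ℝ) (u v : ℕ) : ℝ :=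
  ∑ k ∈ Ico (max u 2) v, (a (k + 1) - a k) ^ 2 +
    ((if u = 0 then (a 2 - a 0) ^ 2 else 0) + if u = 1 then (a 2 - a 1) ^ 2 else 0)

theorem edgeWeight_le (ha : Monotone a) {u v : ℕ} (huv : u ≤ v) (hv : 2 ≤ v) :
    edgeWeight a u v ≤ (a v - a u) ^ 2 := by
  unfold edgeWeight
  have h2 := ha hv
  rcases Nat.lt_or_ge u 2 with hu | hu
  · have h := sum_Ico_sq_sub_le ha hv
    rw [max_eq_right hu.le]
    have h1 := ha hu.le
    interval_cases u
    · simp only [if_true, zero_ne_one, if_false]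
      nlinarith
    · simp only [if_true, one_ne_zero, if_false]
      nlinarith
  · have h := sum_Ico_sq_sub_le ha huv
    rw [max_eq_left hu, if_neg (by omega), if_neg (by omega)]
    linarith

/-- Splitting the edge at 2, or at `v - 1` when `u ≥ 2`, leaves a positive cross term. The pair `(0,
2)` must be excluded, as its weight is exact. -/
theorem edgeWeight_lt (ha : Monotone a) {u v : ℕ} (huv : u + 2 ≤ v) (hv : 3 ≤ v)
    (hpos : ∀ k, 1 ≤ k → k < v → a k < a (k + 1)) :
    edgeWeight a u v < (a v - a u) ^ 2 := by
  unfold edgeWeight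
  have h2 : a 2 < a v := (hpos 2 (by omega) (by omega)).trans_le (ha hv)
  have h12 := hpos 1 le_rfl (by omega)
  rcases Nat.lt_or_ge u 2 with hu | hu
  · have h := sum_Ico_sq_sub_le ha (by omega : 2 ≤ v)
    rw [max_eq_right hu.le]
    interval_cases u
    · have h01 := ha (Nat.zero_le 1)
      norm_num at h12
      simp only [if_true, zero_ne_one, if_false]
      nlinarith
    · norm_num at h12
      simp only [if_true, one_ne_zero, if_false]
      nlinarith
  · obtain ⟨w, rfl⟩ : ∃ w, v = w + 1 := ⟨v - 1, by omega⟩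
    have h := sum_Ico_sq_sub_le ha (by omega : u ≤ w)
    rw [max_eq_left hu, if_neg (by omega), if_neg (by omega), sum_Ico_succ_top (by omega)]
    have h3 := hpos w (by omega) (by omega)
    have h4 : a u < a w := (hpos u (by omega) (by omega)).trans_le (ha (by omega))
    nlinarith

/-- Besides the gaps from 2 on, 0 and 1 each have an opposite-sign neighbour. It is larger than they
are, because 0 and 1 have equal signs. -/
theorem sum_edgeWeight_ge (hm : 3 ≤ m) (hcut : (H.cutGraph ε).CrossesCuts)
    (h01 : ε ⟨0, by omega⟩ = ε ⟨1, by omega⟩) :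
    (a 2 - a 0) ^ 2 + (a 2 - a 1) ^ 2 + ∑ k ∈ Ico 2 (m - 1), (a (k + 1) - a k) ^ 2 ≤
      ∑ p ∈ (H.cutGraph ε).increasingEdges, edgeWeight a p.1 p.2 := by
  unfold edgeWeight
  rw [sum_add_distrib, add_comm, sum_add_distrib]
  refine add_le_add (sum_Ico_le_sum_edges _ hcut.exists_increasingEdges 2
    (fun k => (a (k + 1) - a k) ^ 2) fun _ => sq_nonneg _) (add_le_add ?_ ?_)
  · obtain ⟨j, hj⟩ := hcut.exists_adj (by omega) ⟨0, by omega⟩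
    have hj0 : (⟨0, by omega⟩, j) ∈ (H.cutGraph ε).increasingEdges := by
      refine mem_increasingEdges.2 ⟨?_, hj⟩
      have := Fin.val_ne_of_ne hj.ne
      rw [Fin.lt_def]
      simp only at this ⊢
      omega
    refine le_trans (le_of_eq (if_pos rfl).symm) (single_le_sum (f := fun p : Fin m × Fin m =>
      if (p.1 : ℕ) = 0 then (a 2 - a 0) ^ 2 else 0) (fun q _ => ?_) hj0)
    positivity
  · obtain ⟨j, hj⟩ := hcut.exists_adj (by omega) ⟨1, by omega⟩
    have hj0 : (⟨1, by omega⟩, j) ∈ (H.cutGraph ε).increasingEdges := by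
      refine mem_increasingEdges.2 ⟨?_, hj⟩
      have h1 := Fin.val_ne_of_ne hj.ne
      have h2 : (j : ℕ) ≠ 0 := by
        intro h
        have : j = ⟨0, by omega⟩ := Fin.ext h
        exact hj.2 (by rw [this, h01])
      rw [Fin.lt_def]
      simp only at h1 ⊢
      omega
    refine le_trans (le_of_eq (if_pos rfl).symm) (single_le_sum (f := fun p : Fin m × Fin m =>
      if (p.1 : ℕ) = 1 then (a 2 - a 1) ^ 2 else 0) (fun q _ => ?_) hj0)
    positivity

theorem two_le_of_mem_cutGraph (hm : 3 ≤ m)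
    (h01 : ε ⟨0, by omega⟩ = ε ⟨1, by omega⟩) {p : Fin m × Fin m}
    (hp : p ∈ (H.cutGraph ε).increasingEdges) : 2 ≤ (p.2 : ℕ) := by
  obtain ⟨hlt, hadj⟩ := mem_increasingEdges.1 hp
  by_contra! h
  rw [Fin.lt_def] at hlt
  have h1 : p.1 = ⟨0, by omega⟩ := Fin.ext (by simp only; omega)
  have h2 : p.2 = ⟨1, by omega⟩ := Fin.ext (by simp only; omega)
  exact hadj.2 (by rw [h1, h2, h01])

theorem lollipopForm_le_of_adj (hm : 3 ≤ m) (hcut : (H.cutGraph ε).CrossesCuts)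
    (ha : Monotone a) (h01 : ε ⟨0, by omega⟩ = ε ⟨1, by omega⟩)
    (hadj : H.Adj ⟨0, by omega⟩ ⟨1, by omega⟩) :
    lollipopForm m a ≤ H.signlessForm (fun i => ((ε i : ℤ) : ℝ) * a i) := by
  have hmem : ((⟨0, by omega⟩, ⟨1, by omega⟩) : Fin m × Fin m) ∈
      H.increasingEdges.filter fun p => ε p.1 = ε p.2 :=
    mem_filter.2 ⟨mem_increasingEdges.2 ⟨by simp [Fin.lt_def], hadj⟩, h01⟩
  have h1 := sum_edgeWeight_ge (a := a) hm hcut h01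
  have h2 : ∑ p ∈ (H.cutGraph ε).increasingEdges, edgeWeight a p.1 p.2 ≤
      ∑ p ∈ (H.cutGraph ε).increasingEdges, (a p.2 - a p.1) ^ 2 :=
    sum_le_sum fun p hp => edgeWeight_le ha (mem_increasingEdges.1 hp).1.le
      (two_le_of_mem_cutGraph hm h01 hp)
  have h3 := single_le_sum (f := fun p : Fin m × Fin m => (a p.1 + a p.2) ^ 2)
    (fun q _ => sq_nonneg _) hmem
  rw [signlessForm_split, lollipopForm]
  simp only at h3
  linarith

theorem lollipop_adj {g m : ℕ} {i j : Fin m} : (lollipop g m).Adj i j ↔ i ≠ j ∧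
    (((j : ℕ) = i + 1 ∨ ((i : ℕ) = 0 ∧ (j : ℕ) + 1 = g)) ∨
      ((i : ℕ) = j + 1 ∨ ((j : ℕ) = 0 ∧ (i : ℕ) + 1 = g))) := Iff.rfl

/-- Every estimate must be sharp. A second equal-sign edge would cost a positive amount, and an
opposite-sign edge other than `(k, k + 1)` or `(0, 2)` would lose strictly. Connectivity of the cut
graph then forces all the remaining edges to be present. -/
theorem eq_lollipop_of_adj (hm : 3 ≤ m) (hcut : (H.cutGraph ε).CrossesCuts)
    (ha : Monotone a) (h01 : ε ⟨0, by omega⟩ = ε ⟨1, by omega⟩)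
    (hadj : H.Adj ⟨0, by omega⟩ ⟨1, by omega⟩) (h0 : 0 < a 0)
    (hpos : ∀ k, 1 ≤ k → k + 1 < m → a k < a (k + 1))
    (heq : H.signlessForm (fun i => ((ε i : ℤ) : ℝ) * a i) ≤ lollipopForm m a) :
    H = lollipop 3 m := by
  have hmem : ((⟨0, by omega⟩, ⟨1, by omega⟩) : Fin m × Fin m) ∈
      H.increasingEdges.filter fun p => ε p.1 = ε p.2 :=
    mem_filter.2 ⟨mem_increasingEdges.2 ⟨by simp [Fin.lt_def], hadj⟩, h01⟩
  have h1 := sum_edgeWeight_ge (a := a) hm hcut h01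
  have hle : ∀ p ∈ (H.cutGraph ε).increasingEdges, edgeWeight a p.1 p.2 ≤ (a p.2 - a p.1) ^ 2 :=
    fun p hp => edgeWeight_le ha (mem_increasingEdges.1 hp).1.le
      (two_le_of_mem_cutGraph hm h01 hp)
  have h2 := sum_le_sum hle
  rw [signlessForm_split, lollipopForm, ← add_sum_erase _ _ hmem] at heq
  simp only at heq
  have h3 : 0 ≤ ∑ p ∈ (H.increasingEdges.filter fun p => ε p.1 = ε p.2).erase
    (⟨0, by omega⟩, ⟨1, by omega⟩), (a p.1 + a p.2) ^ 2 := sum_nonneg fun _ _ => sq_nonneg _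
  have h4 := (sum_eq_sum_iff_of_le hle).1 (by linarith)
  have h5 := (sum_eq_zero_iff_of_nonneg fun p _ => sq_nonneg (a p.1 + a p.2)).1
    (le_antisymm (by linarith) h3)
  have hcutle : ∀ p ∈ (H.cutGraph ε).increasingEdges,
      (p.2 : ℕ) = p.1 + 1 ∨ ((p.1 : ℕ) = 0 ∧ (p.2 : ℕ) = 2) := by
    intro p hp
    by_contra! hne
    have hp2 := two_le_of_mem_cutGraph hm h01 hp
    have hp1 := Fin.lt_def.1 (mem_increasingEdges.1 hp).1
    have := p.2.isLt
    refine (edgeWeight_lt (u := p.1) (v := p.2) ha (by omega) (by omega)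
      fun k hk hk' => hpos k hk (by omega)).ne (h4 p hp)
  have hsub : ∀ p ∈ H.increasingEdges, (p.2 : ℕ) = p.1 + 1 ∨ ((p.1 : ℕ) = 0 ∧ (p.2 : ℕ) = 2) := by
    intro p hp
    by_cases hs : ε p.1 = ε p.2
    · by_cases hp01 : p = (⟨0, by omega⟩, ⟨1, by omega⟩)
      · simp [hp01]
      · have := h5 p (mem_erase.2 ⟨hp01, mem_filter.2 ⟨hp, hs⟩⟩)
        have h6 := ha (Nat.zero_le p.1)
        have h7 := ha (Nat.zero_le p.2)
        have h8 : 0 < a p.1 + a p.2 := by linarith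
        exact absurd this (pow_pos h8 2).ne'
    · have hp' := mem_increasingEdges.1 hp
      exact hcutle p (mem_increasingEdges.2 ⟨hp'.1, hp'.2, hs⟩)
  have hsup : ∀ i j : Fin m, i < j → ((j : ℕ) = i + 1 ∨ ((i : ℕ) = 0 ∧ (j : ℕ) = 2)) →
      H.Adj i j := by
    intro i j hij h
    have hend : ∀ i : Fin m, (i : ℕ) ≤ 1 → H.Adj i ⟨2, by omega⟩ := by
      intro i hi
      obtain ⟨j, hj⟩ := hcut.exists_adj (by omega) i
      have hj' : (j : ℕ) = 2 := by
        rcases lt_or_gt_of_ne hj.ne with hlt | hlt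
        · have hmem : (i, j) ∈ (H.cutGraph ε).increasingEdges := mem_increasingEdges.2 ⟨hlt, hj⟩
          have h8 := two_le_of_mem_cutGraph hm h01 hmem
          have h9 := hcutle _ hmem
          simp only at h8 h9
          omega
        · have hmem : (j, i) ∈ (H.cutGraph ε).increasingEdges :=
            mem_increasingEdges.2 ⟨hlt, hj.symm⟩
          have h8 := two_le_of_mem_cutGraph hm h01 hmem
          simp only at h8
          omega
      have : j = ⟨2, by omega⟩ := Fin.ext hj'
      exact this ▸ hj.1
    by_cases hi : (i : ℕ) ≤ 1
    · by_cases hj : (j : ℕ) = 2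
      · have : j = ⟨2, by omega⟩ := Fin.ext hj
        exact this ▸ hend i hi
      · have h8 : i = ⟨0, by omega⟩ := Fin.ext (by simp only; omega)
        have h9 : j = ⟨1, by omega⟩ := Fin.ext (by simp only; omega)
        rw [h8, h9]
        exact hadj
    -- For `i ≥ 2` the only admissible pair across the gap after `i` is `(i, i + 1)`.
    · obtain ⟨p, hp, hp1, hp2⟩ := hcut.exists_increasingEdges i (by omega)
      have h8 := hcutle p hp
      have h9 : p.1 = i := Fin.ext (by omega)
      have h10 : p.2 = j := Fin.ext (by omega)
      rw [← h9, ← h10]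
      exact (mem_increasingEdges.1 hp).2.1
  ext i j
  rw [lollipop_adj]
  constructor
  · intro h
    refine ⟨h.ne, ?_⟩
    rcases lt_or_gt_of_ne h.ne with hlt | hlt
    · have := hsub (i, j) (mem_increasingEdges.2 ⟨hlt, h⟩)
      simp only at this
      omega
    · have := hsub (j, i) (mem_increasingEdges.2 ⟨hlt, h.symm⟩)
      simp only at this
      omega
  · rintro ⟨hne, h⟩
    rcases lt_or_gt_of_ne hne with hlt | hlt
    · refine hsup i j hlt ?_
      rw [Fin.lt_def] at hlt
      omega
    · refine (hsup j i hlt ?_).symm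
      rw [Fin.lt_def] at hlt
      omega

/-- The equal-sign edge costs at least `(a 0 + a 2) ^ 2`, and the gaps cost a whole path. Exchanging
`(a 0 + a 2) ^ 2 + (a 1 - a 0) ^ 2` for `(a 0 + a 1) ^ 2 + (a 2 - a 0) ^ 2` leaves the surplus `4 *
(a 0 * (a 2 - a 1))`. -/
theorem lollipopForm_add_le (hm : 3 ≤ m) (hcut : (H.cutGraph ε).CrossesCuts)
    (ha : Monotone a) (h0 : 0 ≤ a 0) {i j : Fin m} (hij : i < j) (hj : 2 ≤ (j : ℕ))
    (hadj : H.Adj i j) (hε : ε i = ε j) :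
    lollipopForm m a + 4 * (a 0 * (a 2 - a 1)) ≤
      H.signlessForm (fun i => ((ε i : ℤ) : ℝ) * a i) := by
  have hmem : (i, j) ∈ H.increasingEdges.filter fun p => ε p.1 = ε p.2 :=
    mem_filter.2 ⟨mem_increasingEdges.2 ⟨hij, hadj⟩, hε⟩
  have h1 := sum_Ico_le_sum_edges _ hcut.exists_increasingEdges 0
    (fun k => (a (k + 1) - a k) ^ 2) fun _ => sq_nonneg _
  have h2 : ∑ p ∈ (H.cutGraph ε).increasingEdges,
        ∑ k ∈ Ico (max (p.1 : ℕ) 0) p.2, (a (k + 1) - a k) ^ 2 ≤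
      ∑ p ∈ (H.cutGraph ε).increasingEdges, (a p.2 - a p.1) ^ 2 :=
    sum_le_sum fun p hp => by
      rw [Nat.max_zero]
      exact sum_Ico_sq_sub_le ha (mem_increasingEdges.1 hp).1.le
  have h3 := single_le_sum (f := fun p : Fin m × Fin m => (a p.1 + a p.2) ^ 2)
    (fun q _ => sq_nonneg _) hmem
  rw [signlessForm_split, lollipopForm]
  simp only at h1 h3
  rw [← sum_Ico_consecutive _ (Nat.zero_le 2) (by omega : 2 ≤ m - 1)] at h1
  have h4 : ∑ k ∈ Ico 0 2, (a (k + 1) - a k) ^ 2 = (a 1 - a 0) ^ 2 + (a 2 - a 1) ^ 2 := by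
    simp [Finset.sum_range_succ]
  rw [h4] at h1
  have h5 : (a 0 + a 2) ^ 2 ≤ (a i + a j) ^ 2 := by
    have h6 := ha (Nat.zero_le i)
    have h7 := ha hj
    have h8 := ha (Nat.zero_le 2)
    exact pow_le_pow_left₀ (by linarith) (by linarith) 2
  nlinarith

end Rearrangement

/-! ### The extremal graph and its minimizers -/

section Lollipop

variable {m : ℕ}

theorem signlessForm_lollipop (hm : 3 ≤ m) (x : ℕ → ℝ) :
    (lollipop 3 m).signlessForm (fun i => x i) =
      (x 0 + x 2) ^ 2 + ∑ k ∈ range (m - 1), (x k + x (k + 1)) ^ 2 := by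
  have hmem : ((⟨0, by omega⟩, ⟨2, by omega⟩) : Fin m × Fin m) ∈
      (lollipop 3 m).increasingEdges :=
    mem_increasingEdges.2 ⟨by simp [Fin.lt_def], by simp [lollipop_adj]⟩
  rw [signlessForm_eq_sum_increasingEdges, ← add_sum_erase _ _ hmem]
  congr 1
  symm
  refine sum_bij (fun k hk => ((⟨k, by rw [mem_range] at hk; omega⟩,
    ⟨k + 1, by rw [mem_range] at hk; omega⟩) : Fin m × Fin m)) ?_ ?_ ?_ ?_
  · intro k hk
    rw [mem_erase, mem_increasingEdges, lollipop_adj]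
    refine ⟨?_, ?_, ?_, ?_⟩ <;> simp [Prod.ext_iff, Fin.ext_iff, Fin.lt_def]
    omega
  · intro k _ l _ h
    simpa using congrArg (fun p : Fin m × Fin m => (p.1 : ℕ)) h
  · rintro ⟨u, v⟩ huv
    rw [mem_erase, mem_increasingEdges, lollipop_adj] at huv
    obtain ⟨hne, hlt, -, h⟩ := huv
    simp only [ne_eq, Prod.ext_iff, Fin.ext_iff, Fin.lt_def] at hne hlt h
    have := v.isLt
    refine ⟨u, mem_range.2 (by omega), Prod.ext rfl (Fin.ext ?_)⟩
    simp only
    omega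
  · intro k _
    rfl

/-- Signs of the entries of an eigenvector for the least eigenvalue of the triangle with a pendant
path. -/
def lollipopSign : ℕ → ℝ
  | 0 => 1
  | k + 1 => (-1) ^ k

theorem lollipopSign_sq (k : ℕ) : lollipopSign k ^ 2 = 1 := by
  cases k with
  | zero => simp [lollipopSign]
  | succ k => rw [lollipopSign, ← pow_mul, mul_comm, pow_mul]; simp

theorem signlessForm_lollipop_sign (hm : 3 ≤ m) (a : ℕ → ℝ) :
    (lollipop 3 m).signlessForm (fun i => lollipopSign i * a i) = lollipopForm m a := by
  rw [signlessForm_lollipop hm fun k => lollipopSign k * a k, lollipopForm, range_eq_Ico,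
    ← sum_Ico_consecutive _ (Nat.zero_le 2) (by omega : 2 ≤ m - 1)]
  have h : ∀ k ∈ Ico 2 (m - 1), (lollipopSign k * a k + lollipopSign (k + 1) * a (k + 1)) ^ 2 =
      (a (k + 1) - a k) ^ 2 := by
    intro k hk
    obtain ⟨l, rfl⟩ : ∃ l, k = l + 1 := ⟨k - 1, by rw [mem_Ico] at hk; omega⟩
    have h1 : lollipopSign (l + 1 + 1) = -lollipopSign (l + 1) := by
      simp [lollipopSign, pow_succ]
    calc _ = lollipopSign (l + 1) ^ 2 * (a (l + 1 + 1) - a (l + 1)) ^ 2 := by rw [h1]; ring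
      _ = _ := by rw [lollipopSign_sq, one_mul]
  rw [sum_congr rfl h]
  simp [sum_range_succ, lollipopSign]
  ring

/-- The quadratic form of the corona of the triangle with a pendant path, as a function of the
absolute values on the base graph and on the pendant vertices. -/
def coronaForm (m : ℕ) (a b : ℕ → ℝ) : ℝ :=
  lollipopForm m a + ∑ k ∈ range m, (a k - b k) ^ 2

/-- The test vector has alternating signs except on the edge `01`, and each pendant vertex has the
sign opposite to its neighbour. -/
theorem qMin_lollipopCorona_mul_le (hm : 3 ≤ m) (a b : ℕ → ℝ) :
    (lollipopCorona m).qMin * ∑ k ∈ range m, (a k ^ 2 + b k ^ 2) ≤ coronaForm m a b := by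
  have h := (lollipopCorona m).qMin_mul_le
    (Sum.elim (fun i => lollipopSign i * a i) fun p => -(lollipopSign p.1 * b p.1))
  rw [signlessForm_corona] at h
  simp only [Sum.elim_inl, Sum.elim_inr, Fintype.sum_sum_type, Fintype.sum_prod_type, univ_unique,
    sum_singleton, neg_sq, mul_pow, lollipopSign_sq, one_mul, ← sub_eq_add_neg, ← mul_sub] at h
  rw [signlessForm_lollipop_sign hm, ← sum_add_distrib,
    Fin.sum_univ_eq_sum_range (fun k => a k ^ 2 + b k ^ 2),
    Fin.sum_univ_eq_sum_range (fun k => (a k - b k) ^ 2)] at h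
  exact h

/-- The bilinear form associated with `coronaForm`. -/
def coronaPolar (m : ℕ) (a b h g : ℕ → ℝ) : ℝ :=
  (a 0 + a 1) * (h 0 + h 1) + (a 2 - a 0) * (h 2 - h 0) + (a 2 - a 1) * (h 2 - h 1) +
    ∑ k ∈ Ico 2 (m - 1), (a (k + 1) - a k) * (h (k + 1) - h k) +
    ∑ k ∈ range m, (a k - b k) * (h k - g k)

theorem coronaForm_add_mul (m : ℕ) (a b h g : ℕ → ℝ) (t : ℝ) :
    coronaForm m (fun k => a k + t * h k) (fun k => b k + t * g k) =
      coronaForm m a b + 2 * t * coronaPolar m a b h g + t ^ 2 * coronaForm m h g := by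
  have h1 : ∑ k ∈ Ico 2 (m - 1), (a (k + 1) + t * h (k + 1) - (a k + t * h k)) ^ 2 =
      ∑ k ∈ Ico 2 (m - 1), (a (k + 1) - a k) ^ 2 +
        2 * t * ∑ k ∈ Ico 2 (m - 1), (a (k + 1) - a k) * (h (k + 1) - h k) +
        t ^ 2 * ∑ k ∈ Ico 2 (m - 1), (h (k + 1) - h k) ^ 2 := by
    rw [mul_sum, mul_sum, ← sum_add_distrib, ← sum_add_distrib]
    exact sum_congr rfl fun _ _ => by ring
  have h2 : ∑ k ∈ range m, (a k + t * h k - (b k + t * g k)) ^ 2 =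
      ∑ k ∈ range m, (a k - b k) ^ 2 + 2 * t * ∑ k ∈ range m, (a k - b k) * (h k - g k) +
        t ^ 2 * ∑ k ∈ range m, (h k - g k) ^ 2 := by
    rw [mul_sum, mul_sum, ← sum_add_distrib, ← sum_add_distrib]
    exact sum_congr rfl fun _ _ => by ring
  simp only [coronaForm, lollipopForm, coronaPolar]
  rw [h1, h2]
  ring

variable {a b : ℕ → ℝ} {q : ℝ}

/-- Along the line through the minimizer, the form minus `q` times the squared norm is a nonnegative
quadratic in `t` vanishing at 0, so its linear coefficient is zero. -/
theorem coronaPolar_eq (hq : ∀ a b, q * ∑ k ∈ range m, (a k ^ 2 + b k ^ 2) ≤ coronaForm m a b)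
    (hab : coronaForm m a b = q * ∑ k ∈ range m, (a k ^ 2 + b k ^ 2)) (h g : ℕ → ℝ) :
    coronaPolar m a b h g = q * ∑ k ∈ range m, (a k * h k + b k * g k) := by
  have hsum : ∀ t : ℝ, ∑ k ∈ range m, ((a k + t * h k) ^ 2 + (b k + t * g k) ^ 2) =
      ∑ k ∈ range m, (a k ^ 2 + b k ^ 2) + 2 * t * ∑ k ∈ range m, (a k * h k + b k * g k) +
        t ^ 2 * ∑ k ∈ range m, (h k ^ 2 + g k ^ 2) := by
    intro t
    rw [mul_sum, mul_sum, ← sum_add_distrib, ← sum_add_distrib]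
    exact sum_congr rfl fun _ _ => by ring
  have hd := discrim_le_zero (a := coronaForm m h g - q * ∑ k ∈ range m, (h k ^ 2 + g k ^ 2))
    (b := 2 * (coronaPolar m a b h g - q * ∑ k ∈ range m, (a k * h k + b k * g k))) (c := 0)
    fun t => by
      have h1 := hq (fun k => a k + t * h k) (fun k => b k + t * g k)
      rw [coronaForm_add_mul, hsum, hab] at h1
      nlinarith
  rw [discrim] at hd
  nlinarith [sq_nonneg (coronaPolar m a b h g - q * ∑ k ∈ range m, (a k * h k + b k * g k))]

/-- The Euler equations of a minimizer of the Rayleigh quotient of `coronaForm`. -/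
theorem euler_equations (hm : 3 ≤ m)
    (hq : ∀ a b, q * ∑ k ∈ range m, (a k ^ 2 + b k ^ 2) ≤ coronaForm m a b)
    (hab : coronaForm m a b = q * ∑ k ∈ range m, (a k ^ 2 + b k ^ 2)) :
    (∀ j < m, b j - a j = q * b j) ∧
    (a 0 + a 1 - (a 2 - a 0) + (a 0 - b 0) = q * a 0) ∧
    (a 0 + a 1 - (a 2 - a 1) + (a 1 - b 1) = q * a 1) ∧
    (a 2 - a 0 + (a 2 - a 1) + ∑ j ∈ range m, (if 2 ≤ j then a j - b j else 0) =
      q * ∑ j ∈ range m, if 2 ≤ j then a j else 0) ∧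
    (∀ k, 2 ≤ k → k + 1 < m →
      a (k + 1) - a k + ∑ j ∈ range m, (if k < j then a j - b j else 0) =
        q * ∑ j ∈ range m, if k < j then a j else 0) := by
  have key := coronaPolar_eq hq hab
  refine ⟨fun j hj => ?_, ?_, ?_, ?_, fun k hk hkm => ?_⟩
  · have h := key 0 (fun k => if k = j then 1 else 0)
    simpa [coronaPolar, hj] using h
  · have h := key (fun k => if k = 0 then 1 else 0) 0
    rw [coronaPolar, sum_eq_zero (s := Ico 2 (m - 1))] at h
    · simp [show 0 < m by omega] at h
      linarith
    · intro k hk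
      rw [mem_Ico] at hk
      simp [show k ≠ 0 by omega]
  · have h := key (fun k => if k = 1 then 1 else 0) 0
    rw [coronaPolar, sum_eq_zero (s := Ico 2 (m - 1))] at h
    · simp [show 1 < m by omega] at h
      linarith
    · intro k hk
      rw [mem_Ico] at hk
      simp [show k ≠ 0 by omega, show k ≠ 1 by omega]
  -- Tail indicators sum the eigenvalue equations: the path differences telescope, and only the
  -- edges entering the tail survive.
  · have h := key (fun k => if 2 ≤ k then 1 else 0) 0
    rw [coronaPolar, sum_eq_zero (s := Ico 2 (m - 1))] at h
    · simpa using h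
    · intro k hk
      rw [mem_Ico] at hk
      simp [show 2 ≤ k by omega, show 2 ≤ k + 1 by omega]
  · have h := key (fun j => if k < j then 1 else 0) 0
    rw [coronaPolar, sum_eq_single_of_mem (s := Ico 2 (m - 1)) k
      (mem_Ico.2 ⟨hk, by omega⟩)] at h
    · simpa [show ¬ k < 2 by omega, show ¬ k < 1 by omega] using h
    · intro j _ hjk
      by_cases h' : k < j
      · simp [h', show k < j + 1 by omega]
      · simp [h', show ¬ k < j + 1 by omega]

theorem lollipopForm_nonneg (m : ℕ) (a : ℕ → ℝ) : 0 ≤ lollipopForm m a := by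
  unfold lollipopForm
  positivity

/-- After elimination of `b`, each gap `a (k + 1) - a k` with `k ≥ 2` is a positive multiple of the
tail sum beyond `k`. The hypothesis `4 ≤ m` matters: on a triangle the values `0, 1, 1` also come
from a minimizer. -/
theorem rigid_of_minimizer (hm : 4 ≤ m)
    (hq : ∀ a b, q * ∑ k ∈ range m, (a k ^ 2 + b k ^ 2) ≤ coronaForm m a b)
    (hab : coronaForm m a b = q * ∑ k ∈ range m, (a k ^ 2 + b k ^ 2))
    (ha : Monotone a) (h0 : 0 ≤ a 0) (hb : ∀ k, 0 ≤ b k)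
    (hpos : 0 < ∑ k ∈ range m, (a k ^ 2 + b k ^ 2)) :
    a 0 = a 1 ∧ 0 < a 0 ∧ ∀ k, 1 ≤ k → k + 1 < m → a k < a (k + 1) := by
  obtain ⟨hpend, he0, he1, he2, hek⟩ := euler_equations (by omega) hq hab
  have hane : ∀ k, 0 ≤ a k := fun k => h0.trans (ha k.zero_le)
  have hnz : ¬ ∀ k < m, a k = 0 ∧ b k = 0 := by
    intro h
    refine hpos.ne' (sum_eq_zero fun k hk => ?_)
    obtain ⟨h1, h2⟩ := h k (mem_range.1 hk)
    simp [h1, h2]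
  have hq1 : q ≤ 1 := by
    have h := hq 0 (fun k => if k = 0 then 1 else 0)
    simpa [coronaForm, lollipopForm, show 0 < m by omega] using h
  have hq1' : q < 1 := by
    refine lt_of_le_of_ne hq1 fun h => hnz ?_
    subst h
    have ha0 : ∀ k < m, a k = 0 := fun k hk => by linarith [hpend k hk]
    have h00 := ha0 0 (by omega)
    have h01 := ha0 1 (by omega)
    have h02 := ha0 2 (by omega)
    rw [sum_congr rfl (g := fun j => -(if 2 ≤ j then b j else 0)),
      sum_eq_zero (f := fun j => if 2 ≤ j then a j else 0), sum_neg_distrib] at he2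
    · have h3 := (sum_eq_zero_iff_of_nonneg fun j _ => by
        split_ifs; exacts [hb j, le_rfl]).1 (by linarith : ∑ j ∈ range m, (if 2 ≤ j then b j else 0) = 0)
      intro k hk
      refine ⟨ha0 k hk, ?_⟩
      rcases Nat.lt_or_ge k 2 with hk2 | hk2
      · interval_cases k <;> linarith
      · simpa [hk2] using h3 k (mem_range.2 hk)
    · intro j hj
      simp [ha0 j (mem_range.1 hj)]
    · intro j hj
      by_cases h : 2 ≤ j <;> simp [ha0 j (mem_range.1 hj), h]
  have hq0 : 0 < q := by
    by_contra! hq0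
    have h1 : 0 ≤ q * ∑ k ∈ range m, (a k ^ 2 + b k ^ 2) := by
      rw [← hab, coronaForm]
      have := lollipopForm_nonneg m a
      positivity
    have h2 : q = 0 := le_antisymm hq0 (nonneg_of_mul_nonneg_left h1 hpos)
    subst h2
    have hba : ∀ k < m, b k = a k := fun k hk => by linarith [hpend k hk]
    have hz : ∀ (P : ℕ → Prop) [DecidablePred P],
        ∑ j ∈ range m, (if P j then a j - b j else 0) = 0 := by
      intro P _
      refine sum_eq_zero fun j hj => ?_
      simp [hba j (mem_range.1 hj)]
    rw [hz] at he2
    rw [hba 0 (by omega)] at he0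
    rw [hba 1 (by omega)] at he1
    have hall : ∀ k < m, a k = 0 := by
      intro k hk
      induction k with
      | zero => linarith
      | succ k ih =>
        rcases Nat.lt_or_ge k 2 with hk2 | hk2
        · interval_cases k <;> norm_num <;> linarith
        · have h3 := hek k hk2 hk
          rw [hz] at h3
          have := ih (by omega)
          linarith
    exact hnz fun k hk => ⟨hall k hk, by rw [hba k hk, hall k hk]⟩
  -- The pendant equation gives `a j = (1 - q) * b j`; eliminating `b` leaves equations in `a` alone
  -- with `μ = q + q / (1 - q)`.
  obtain ⟨μ, hμ, hμa⟩ : ∃ μ : ℝ, 0 < μ ∧ ∀ j < m, q * a j - (a j - b j) = μ * a j := by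
    have h1 : 0 < 1 - q := by linarith
    refine ⟨q + q / (1 - q), by positivity, fun j hj => ?_⟩
    have h2 : a j = (1 - q) * b j := by linarith [hpend j hj]
    rw [h2]
    field_simp
    ring
  have hlast : 0 < a (m - 1) := by
    refine lt_of_le_of_ne (hane _) fun h => hnz fun k hk => ?_
    have h1 : a k = 0 := le_antisymm ((ha (by omega)).trans h.symm.le) (hane k)
    refine ⟨h1, ?_⟩
    have h2 := hpend k hk
    rw [h1, sub_zero] at h2
    have h3 : (1 - q) * b k = 0 := by linarith
    exact (mul_eq_zero.1 h3).resolve_left (by linarith)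
  have hsum : ∀ (P : ℕ → Prop) [DecidablePred P],
      q * ∑ j ∈ range m, (if P j then a j else 0) -
        ∑ j ∈ range m, (if P j then a j - b j else 0) =
      μ * ∑ j ∈ range m, (if P j then a j else 0) := by
    intro P _
    rw [mul_sum, mul_sum, ← sum_sub_distrib]
    refine sum_congr rfl fun j hj => ?_
    split_ifs
    · exact hμa j (mem_range.1 hj)
    · simp
  have htail : ∀ k, k + 1 < m → 0 < ∑ j ∈ range m, if k < j then a j else 0 := by
    intro k hk
    refine sum_pos' (fun j _ => ?_) ⟨m - 1, mem_range.2 (by omega), ?_⟩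
    · split_ifs
      exacts [hane j, le_rfl]
    · rwa [if_pos (by omega)]
  have hstep : ∀ k, 2 ≤ k → k + 1 < m → a k < a (k + 1) := by
    intro k hk hkm
    have h1 := hek k hk hkm
    have h2 := hsum (fun j => k < j)
    have h3 := mul_pos hμ (htail k hkm)
    linarith
  have hsplit : ∑ j ∈ range m, (if 2 ≤ j then a j else 0) =
      a 2 + ∑ j ∈ range m, if 2 < j then a j else 0 := by
    have h1 : ∀ j ∈ range m, (if 2 ≤ j then a j else 0) =
        (if j = 2 then a 2 else 0) + if 2 < j then a j else 0 := by
      intro j _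
      rcases lt_trichotomy j 2 with h | h | h
      · simp [h.not_ge, h.ne, h.not_gt]
      · simp [h]
      · simp [h.le, h.ne', h]
    rw [sum_congr rfl h1, sum_add_distrib]
    simp [show 2 < m by omega]
  have hs2 := hsum (fun j => 2 ≤ j)
  rw [hsplit] at hs2 he2
  have ht2 := htail 2 (by omega)
  have hμ0 := hμa 0 (by omega)
  have hμ1 := hμa 1 (by omega)
  -- Subtract the equations at 0 and 1. If `μ = 1`, they give `a 0 + a 1 = a 2`, and the equation
  -- for the tail from 2 makes the sum beyond 2 vanish, contradicting `ht2`.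
  have heq : a 0 = a 1 := by
    have h1 : (1 - μ) * (a 0 - a 1) = 0 := by linarith
    rcases mul_eq_zero.1 h1 with h2 | h2
    · obtain rfl : μ = 1 := by linarith
      linarith
    · linarith
  have hgap : a 1 < a 2 := by
    have h1 : 0 < μ * (a 2 + ∑ j ∈ range m, if 2 < j then a j else 0) :=
      mul_pos hμ (by linarith [hane 2])
    linarith
  refine ⟨heq, ?_, fun k hk hkm => ?_⟩
  · refine lt_of_le_of_ne h0 fun h => ?_
    have h1 : μ * a 0 = 0 := by rw [← h, mul_zero]
    linarith
  · rcases Nat.lt_or_ge k 2 with hk2 | hk2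
    · interval_cases k
      exact hgap
    · exact hstep k hk2 hkm

end Lollipop

/-! ### Graphs with domination number half the order -/

section Domination

variable {V : Type*} [Fintype V] {G : SimpleGraph V}

theorem dominationNumber_le_card {D : Finset V} (hD : G.IsDominatingSet D) :
    G.dominationNumber ≤ D.card :=
  Nat.sInf_le ⟨D, hD, rfl⟩

theorem exists_card_eq_dominationNumber (G : SimpleGraph V) :
    ∃ D : Finset V, G.IsDominatingSet D ∧ D.card = G.dominationNumber :=
  Nat.sInf_mem (s := {k : ℕ | ∃ D : Finset V, G.IsDominatingSet D ∧ D.card = k})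
    ⟨_, univ, fun v hv => absurd (mem_univ v) hv, rfl⟩

/-- Bollobás–Cockayne: a graph without isolated vertices has a minimum dominating set all of whose
vertices have an external private neighbour. -/
theorem exists_dominatingSet_private (hG : ∀ v, ∃ u, G.Adj v u) :
    ∃ D : Finset V, D.card = G.dominationNumber ∧
      ∀ v ∈ D, ∃ w ∉ D, G.Adj v w ∧ ∀ u ∈ D, G.Adj u w → u = v := by
  classical
  obtain ⟨D₀, hD₀⟩ := exists_card_eq_dominationNumber G
  let A : Finset (Finset V) := univ.filter fun D =>
    G.IsDominatingSet D ∧ D.card = G.dominationNumber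
  let e : Finset V → Finset (V × V) := fun D =>
    univ.filter fun p => p.1 ∈ D ∧ p.2 ∈ D ∧ G.Adj p.1 p.2
  -- Maximize the number of edges inside `D`. A vertex `v` without a private neighbour outside is
  -- isolated in `D`, and exchanging it for a neighbour `u` gains an inner edge.
  obtain ⟨D, hD, hmax⟩ := exists_max_image A (fun D => (e D).card)
    ⟨D₀, mem_filter.2 ⟨mem_univ _, hD₀⟩⟩
  obtain ⟨hdom, hcard⟩ := (mem_filter.1 hD).2
  refine ⟨D, hcard, fun v hv => ?_⟩
  by_contra! hno
  have hother : ∀ x ∉ D, ∃ u ∈ D.erase v, G.Adj u x := by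
    intro x hx
    obtain ⟨y, hy, hyx⟩ := hdom x hx
    by_cases h : y = v
    · obtain ⟨u, hu, hux, huv⟩ := hno x hx (h ▸ hyx)
      exact ⟨u, mem_erase.2 ⟨huv, hu⟩, hux⟩
    · exact ⟨y, mem_erase.2 ⟨h, hy⟩, hyx⟩
  have hisol : ∀ u ∈ D, ¬ G.Adj u v := by
    intro u hu huv
    have hdom' : G.IsDominatingSet (D.erase v) := by
      intro x hx
      by_cases hxv : x = v
      · exact ⟨u, mem_erase.2 ⟨huv.ne, hu⟩, hxv ▸ huv⟩
      · exact hother x fun h => hx (mem_erase.2 ⟨hxv, h⟩)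
    have h1 := dominationNumber_le_card hdom'
    have h2 := card_erase_lt_of_mem hv
    omega
  obtain ⟨u, hvu⟩ := hG v
  have hu : u ∉ D := fun h => hisol u h hvu.symm
  obtain ⟨t, ht, htu⟩ := hother u hu
  have hD' : insert u (D.erase v) ∈ A := by
    refine mem_filter.2 ⟨mem_univ _, ?_, ?_⟩
    · intro x hx
      rw [mem_insert, mem_erase, not_or, not_and] at hx
      by_cases hxv : x = v
      · exact ⟨u, mem_insert_self _ _, hxv ▸ hvu.symm⟩
      · obtain ⟨y, hy, hyx⟩ := hother x (hx.2 hxv)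
        exact ⟨y, mem_insert_of_mem hy, hyx⟩
    · rw [card_insert_of_notMem (fun h => hu (mem_of_mem_erase h)), card_erase_add_one hv, hcard]
  refine absurd (hmax _ hD') (not_le.2 (card_lt_card ?_))
  rw [Finset.ssubset_iff_of_subset]
  · exact ⟨(t, u), mem_filter.2 ⟨mem_univ _, mem_insert_of_mem ht, mem_insert_self _ _, htu⟩,
      fun h => hu (mem_filter.1 h).2.2.1⟩
  · rintro ⟨x, y⟩ hxy
    obtain ⟨-, hx, hy, hadj⟩ := mem_filter.1 hxy
    simp only at hx hy hadj
    refine mem_filter.2 ⟨mem_univ _, mem_insert_of_mem (mem_erase.2 ⟨?_, hx⟩),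
      mem_insert_of_mem (mem_erase.2 ⟨?_, hy⟩), hadj⟩
    · rintro rfl
      exact hisol y hy hadj.symm
    · rintro rfl
      exact hisol x hx hadj

/-- If the domination number is half the order, there is a minimum dominating set whose edges to
its complement form a perfect matching, described by an involution `p`. -/
theorem exists_matching (hG : ∀ v, ∃ u, G.Adj v u)
    (hcard : 2 * G.dominationNumber = Fintype.card V) :
    ∃ (D : Finset V) (p : V → V), D.card = G.dominationNumber ∧ (∀ x, p (p x) = x) ∧
      (∀ x, p x ∈ D ↔ x ∉ D) ∧ (∀ x, G.Adj x (p x)) ∧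
      ∀ x ∈ D, ∀ y ∉ D, G.Adj x y → y = p x := by
  classical
  obtain ⟨D, hD, hpriv⟩ := exists_dominatingSet_private hG
  choose! w hwD hwadj hwuniq using hpriv
  have hinj : Set.InjOn w D := fun x hx y hy hxy =>
    hwuniq y hy x hx (hxy ▸ hwadj x hx)
  have himg : D.image w = Dᶜ := by
    refine eq_of_subset_of_card_le (fun y hy => ?_) ?_
    · obtain ⟨x, hx, rfl⟩ := mem_image.1 hy
      exact mem_compl.2 (hwD x hx)
    · rw [card_compl, card_image_of_injOn hinj]
      omega
  have hsurj : ∀ y ∉ D, ∃ x ∈ D, w x = y := fun y hy =>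
    mem_image.1 (himg ▸ mem_compl.2 hy)
  choose! g hgD hwg using hsurj
  have hgw : ∀ x ∈ D, g (w x) = x := fun x hx =>
    hinj (hgD _ (hwD x hx)) hx (hwg _ (hwD x hx))
  refine ⟨D, fun x => if x ∈ D then w x else g x, hD, fun x => ?_, fun x => ?_, fun x => ?_,
    fun x hx y hy hxy => ?_⟩
  · by_cases hx : x ∈ D
    · simp [hx, hwD x hx, hgw x hx]
    · simp [hx, hgD x hx, hwg x hx]
  · by_cases hx : x ∈ D
    · simp [hx, hwD x hx]
    · simp [hx, hgD x hx]
  · by_cases hx : x ∈ D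
    · simp [hx, hwadj x hx]
    · have := hwadj _ (hgD x hx)
      rw [hwg x hx] at this
      simp [hx, this.symm]
  · have h : x = g y := hwuniq _ (hgD y hy) x hx ((hwg y hy).symm ▸ hxy)
    simp only [hx, if_true]
    rw [h, hwg y hy]

/-- A connected graph of order at least six whose domination number is half its order is the corona
of an induced subgraph and a single vertex. -/
theorem exists_iso_corona (hconn : G.Connected)
    (hdom : 2 * G.dominationNumber = Fintype.card V) (h6 : 6 ≤ Fintype.card V) :
    ∃ C : Set V, Nonempty ((G.induce C).corona (⊤ : SimpleGraph Unit) ≃g G) := by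
  classical
  have hcross := hconn.crossesCuts
  have hclosed : ∀ Z : Finset V, Z.Nonempty → Z.card < 6 →
      ¬ ∀ x ∈ Z, ∀ y, G.Adj x y → y ∈ Z := by
    intro Z hZ hZ6 h
    have hne : (↑Z : Set V)ᶜ.Nonempty := by
      by_contra! hc
      have : Z = univ := by
        rw [← Finset.coe_eq_univ]
        exact Set.compl_empty_iff.1 hc
      rw [this, card_univ] at hZ6
      omega
    obtain ⟨u, hu, v, hv, huv⟩ := hcross Z hZ hne
    exact hv (h u hu v huv)
  have hnbr : ∀ v, ∃ u, G.Adj v u := by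
    intro v
    by_contra! h
    exact hclosed {v} ⟨v, by simp⟩ (by simp) fun x hx y hxy => by
      rw [mem_singleton] at hx
      exact absurd (hx ▸ hxy) (h y)
  obtain ⟨D, p, hDcard, hpp, hpD, hpadj, hcr⟩ := exists_matching hnbr hdom
  have hpinj : ∀ {x y}, p x = p y → x = y := fun {x y} h => by rw [← hpp x, h, hpp]
  -- Here `j ∈ D` and `k ∉ D`. If `k ≠ p j`, replacing both `x` and `p k` by `k` gives a smaller
  -- dominating set: `j` dominates `x`, and `k` dominates `p x` and `p k`.
  have hunique : ∀ x ∈ D, ∀ j k, G.Adj x j → j ≠ p x → G.Adj (p x) k → k ≠ x → k = p j := by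
    intro x hx j k hxj hj hk hkx
    by_contra hne
    have hjD : j ∈ D := by
      by_contra h
      exact hj (hcr x hx j h hxj)
    have hpx : p x ∉ D := fun h => (hpD x).1 h hx
    have hkD : k ∉ D := fun h => hkx (hpinj (hcr k h _ hpx hk.symm)).symm
    have hpk : p k ∈ D := (hpD k).2 hkD
    have hpkx : p k ≠ x := fun h => hk.ne (by rw [← h, hpp])
    have hjk : j ≠ p k := fun h => hne (by rw [h, hpp])
    have hdomS : G.IsDominatingSet (insert k ((D.erase x).erase (p k))) := by
      intro z hz
      simp only [mem_insert, mem_erase, not_or, not_and] at hz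
      by_cases hzx : z = x
      · refine ⟨j, ?_, hzx ▸ hxj.symm⟩
        simp [hjk, hxj.ne', hjD]
      by_cases hzk : z = p k
      · exact ⟨k, by simp, hzk ▸ hpadj k⟩
      have hzD := hz.2 hzk hzx
      by_cases hpz : p z = x
      · have : z = p x := by rw [← hpz, hpp]
        exact ⟨k, by simp, this ▸ hk.symm⟩
      · refine ⟨p z, ?_, (hpadj z).symm⟩
        have h1 : p z ≠ p k := fun h => hz.1 (hpinj h)
        simp [h1, hpz, (hpD z).2 hzD]
    have h1 := dominationNumber_le_card hdomS
    have h2 := card_insert_le k ((D.erase x).erase (p k))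
    have h3 : ((D.erase x).erase (p k)).card + 1 = (D.erase x).card :=
      card_erase_add_one (mem_erase.2 ⟨hpkx, hpk⟩)
    have h4 := card_erase_add_one hx
    omega
  -- If neither end were a leaf, `hunique` would confine all neighbours to `{x, p x, j, p j}`, a
  -- closed set that is too small.
  have hleafD : ∀ x ∈ D, (∀ y, G.Adj x y → y = p x) ∨ ∀ y, G.Adj (p x) y → y = x := by
    intro x hx
    by_contra! h
    obtain ⟨⟨j, hxj, hj⟩, k, hk, hkx⟩ := h
    obtain rfl := hunique x hx j k hxj hj hk hkx
    have hjD : j ∈ D := by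
      by_contra h
      exact hj (hcr x hx j h hxj)
    have hxpj : x ≠ p j := fun h => (hpD j).1 (h ▸ hx) hjD
    refine hclosed {x, p x, j, p j} ⟨x, by simp⟩ (card_le_four.trans_lt (by norm_num)) ?_
    intro z hz y hzy
    simp only [mem_insert, mem_singleton] at hz ⊢
    rcases hz with rfl | rfl | rfl | rfl
    · by_cases h : y = p z
      · simp [h]
      · have := hpinj (hunique z hx y _ hzy h hk hkx)
        simp [this]
    · by_cases h : y = x
      · simp [h]
      · have := hunique x hx j y hxj hj hzy h
        simp [this]
    · by_cases h : y = p z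
      · simp [h]
      · have := hpinj (hunique z hjD y _ hzy h hk.symm fun h => hj h.symm)
        simp [this]
    · by_cases h : y = j
      · simp [h]
      · have := hunique j hjD x y hxj.symm hxpj hzy h
        simp [this]
  have hleaf : ∀ x, (∀ y, G.Adj x y → y = p x) ∨ ∀ y, G.Adj (p x) y → y = p (p x) := by
    intro x
    rw [hpp]
    by_cases hx : x ∈ D
    · exact hleafD x hx
    · have := hleafD (p x) ((hpD x).2 hx)
      rw [hpp] at this
      exact this.symm
  have hnotboth : ∀ x, ¬ ((∀ y, G.Adj x y → y = p x) ∧ ∀ y, G.Adj (p x) y → y = p (p x)) := by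
    rintro x ⟨h1, h2⟩
    refine hclosed {x, p x} ⟨x, by simp⟩ (card_le_two.trans_lt (by norm_num)) ?_
    intro z hz y hzy
    simp only [mem_insert, mem_singleton] at hz ⊢
    rcases hz with rfl | rfl
    · exact Or.inr (h1 y hzy)
    · exact Or.inl ((h2 y hzy).trans (hpp x))
  -- The non-leaves: each matched pair contains exactly one.
  let C : Set V := {x | ¬ ∀ y, G.Adj x y → y = p x}
  have hCp : ∀ x ∈ C, ∀ y, G.Adj (p x) y → y = x := fun x hx y hy =>
    ((hleaf x).resolve_left hx y hy).trans (hpp x)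
  have hpC : ∀ x ∈ C, p x ∉ C := fun x hx h => h ((hleaf x).resolve_left hx)
  let f : C ⊕ C × Unit → V := Sum.elim (fun c => c) fun q => p q.1
  have hf : Function.Bijective f := by
    constructor
    · rintro (u | ⟨u, _⟩) (v | ⟨v, _⟩) h
      · exact congrArg Sum.inl (Subtype.ext h)
      · exact absurd (show p v ∈ C from (show (u : V) = p v from h) ▸ u.2) (hpC v v.2)
      · exact absurd (show p u ∈ C from (show (v : V) = p u from h.symm) ▸ v.2) (hpC u u.2)
      · have : u = v := Subtype.ext (hpinj h)
        rw [this]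
    · intro x
      by_cases hx : x ∈ C
      · exact ⟨.inl ⟨x, hx⟩, rfl⟩
      · have hx' : ∀ y, G.Adj x y → y = p x := not_not.1 hx
        exact ⟨.inr (⟨p x, fun h => hnotboth x ⟨hx', h⟩⟩, ()), hpp x⟩
  refine ⟨C, ⟨⟨Equiv.ofBijective f hf, ?_⟩⟩⟩
  rintro (u | ⟨u, _⟩) (v | ⟨v, _⟩)
  · exact Iff.rfl
  · refine ⟨fun h => Subtype.ext (hCp v v.2 u (Adj.symm h)), fun h => ?_⟩
    have h' : u = v := h
    rw [h']
    exact hpadj v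
  · refine ⟨fun h => (Subtype.ext (hCp u u.2 v h)).symm, fun h => ?_⟩
    have h' : u = v := h
    rw [h']
    exact (hpadj v).symm
  · refine ⟨fun h => ?_, fun h => absurd h.2 (by simp)⟩
    have h' : p v = u := hCp u u.2 (p v) h
    exact absurd (show p v ∈ C from h'.symm ▸ u.2) (hpC v v.2)

end Domination

/-! ### Comparison of coronas -/

section Corona

variable {W : Type*}

/-- Put each pendant vertex on the side of its neighbour; a crossing edge then lies in the base. -/
theorem CrossesCuts.of_corona {H : SimpleGraph W}
    (h : (H.corona (⊤ : SimpleGraph Unit)).CrossesCuts) : H.CrossesCuts := by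
  rintro S ⟨s, hs⟩ ⟨t, ht⟩
  obtain ⟨u, hu, v, hv, huv⟩ := h {x | Sum.elim id Prod.fst x ∈ S} ⟨.inl s, hs⟩ ⟨.inl t, ht⟩
  rcases u with u | u <;> rcases v with v | v
  · exact ⟨u, hu, v, hv, huv⟩
  · have huv' : u = v.1 := huv
    exact absurd (show v.1 ∈ S from huv' ▸ hu) hv
  · have huv' : u.1 = v := huv
    exact absurd (show v ∈ S from huv' ▸ hu) hv
  · exact absurd huv.2 (by simp)

theorem IsBipartite.corona {H : SimpleGraph W} (h : H.IsBipartite) :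
    (H.corona (⊤ : SimpleGraph Unit)).IsBipartite := by
  obtain ⟨c⟩ := h
  have hne : ∀ i : Fin 2, i ≠ 1 - i := by decide
  refine ⟨Coloring.mk (Sum.elim c fun q => 1 - c q.1) fun {u v} huv => ?_⟩
  rcases u with u | u <;> rcases v with v | v
  · exact c.valid huv
  · have huv' : u = v.1 := huv
    rw [huv']
    exact hne _
  · have huv' : u.1 = v := huv
    rw [← huv']
    exact (hne _).symm
  · exact absurd huv.2 (by simp)

theorem CrossesCuts.comap {X : Type*} {H : SimpleGraph W} (h : H.CrossesCuts) (e : X ≃ W) :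
    (H.comap e).CrossesCuts := by
  rintro S ⟨s, hs⟩ ⟨t, ht⟩
  obtain ⟨u, hu, v, hv, huv⟩ := h {w | e.symm w ∈ S} ⟨e s, by simpa using hs⟩
    ⟨e t, by simpa using ht⟩
  exact ⟨e.symm u, hu, e.symm v, hv, by simpa using huv⟩

/-- The equal-sign edge either is `01` or has larger end at least 2. In the latter case the surplus
is positive under the strictness hypotheses, so equality is impossible. -/
theorem lollipopForm_le_signlessForm {m : ℕ} (hm : 3 ≤ m) {H : SimpleGraph (Fin m)}
    {ε : Fin m → ℤˣ} {a : ℕ → ℝ} (hcut : (H.cutGraph ε).CrossesCuts) (hH : ¬ H.IsBipartite)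
    (ha : Monotone a) (h0 : 0 ≤ a 0) :
    lollipopForm m a ≤ H.signlessForm (fun i => ((ε i : ℤ) : ℝ) * a i) ∧
      (H.signlessForm (fun i => ((ε i : ℤ) : ℝ) * a i) ≤ lollipopForm m a →
        (0 < a 0 ∧ ∀ k, 1 ≤ k → k + 1 < m → a k < a (k + 1)) → H = lollipop 3 m) := by
  obtain ⟨i, j, hij, hadj, hε⟩ : ∃ i j, i < j ∧ H.Adj i j ∧ ε i = ε j := by
    obtain ⟨i, j, hadj, hε⟩ := exists_adj_eq_of_not_isBipartite hH ε
    rcases lt_or_gt_of_ne hadj.ne with h | h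
    exacts [⟨i, j, h, hadj, hε⟩, ⟨j, i, h, hadj.symm, hε.symm⟩]
  rcases Nat.lt_or_ge j 2 with hj | hj
  · rw [Fin.lt_def] at hij
    have hi0 : i = ⟨0, by clear hadj hε; omega⟩ := Fin.ext (by simp only; omega)
    have hj1 : j = ⟨1, by clear hadj hε; omega⟩ := Fin.ext (by simp only; omega)
    rw [hi0, hj1] at hadj hε
    exact ⟨lollipopForm_le_of_adj hm hcut ha hε hadj, fun hle hpos =>
      eq_lollipop_of_adj hm hcut ha hε hadj hpos.1 hpos.2 hle⟩
  · have h := lollipopForm_add_le hm hcut ha h0 hij hj hadj hε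
    have h12 : a 1 ≤ a 2 := ha one_le_two
    refine ⟨?_, fun hle hpos => ?_⟩
    · have := mul_nonneg h0 (sub_nonneg.2 h12)
      linarith
    · have h12' : a 1 < a 2 := hpos.2 1 le_rfl (by omega)
      have := mul_pos hpos.1 (sub_pos.2 h12')
      linarith

variable [Fintype W] {m : ℕ}

/-- The rearrangement of a vector on the corona of a nonbipartite graph into one on the corona of
the triangle with a pendant path. -/
theorem exists_rearrangement (hm : 3 ≤ m) (hW : Fintype.card W = m) {H : SimpleGraph W}
    (hcross : H.CrossesCuts) (hH : ¬ H.IsBipartite) (x z : W → ℝ) :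
    ∃ a b : ℕ → ℝ, Monotone a ∧ 0 ≤ a 0 ∧ (∀ k, 0 ≤ b k) ∧
      ∑ k ∈ range m, (a k ^ 2 + b k ^ 2) = ∑ w, (x w ^ 2 + z w ^ 2) ∧
      coronaForm m a b ≤ H.signlessForm x + ∑ w, (x w + z w) ^ 2 ∧
      (H.signlessForm x + ∑ w, (x w + z w) ^ 2 ≤ coronaForm m a b →
        (0 < a 0 ∧ ∀ k, 1 ≤ k → k + 1 < m → a k < a (k + 1)) →
        Nonempty (H ≃g lollipop 3 m)) := by
  obtain ⟨ε, hcut, hle⟩ := hcross.exists_signs x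
  let e₀ : Fin m ≃ W := (Fintype.equivFinOfCardEq hW).symm
  let e : Fin m ≃ W := (Tuple.sort fun i => |x (e₀ i)|).trans e₀
  have hmono : Monotone fun i => |x (e i)| := Tuple.monotone_sort fun i => |x (e₀ i)|
  -- Indices beyond `m - 1` repeat the last value, so that `a` is monotone on all of `ℕ`.
  let r : ℕ → Fin m := fun k => ⟨min k (m - 1), by omega⟩
  have hr : ∀ i : Fin m, r i = i := fun i => Fin.ext (by simp only [r]; omega)
  have hrm : Monotone r := fun k l hkl => by
    rw [Fin.le_def]
    exact min_le_min_right _ hkl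
  let a : ℕ → ℝ := fun k => |x (e (r k))|
  let b : ℕ → ℝ := fun k => |z (e (r k))|
  have ha : Monotone a := hmono.comp hrm
  have hsum : ∀ f : ℝ → ℝ → ℝ, ∑ k ∈ range m, f (a k) (b k) = ∑ w, f |x w| |z w| := by
    intro f
    rw [← Fin.sum_univ_eq_sum_range (fun k => f (a k) (b k)), ← Equiv.sum_comp e]
    refine sum_congr rfl fun i _ => ?_
    simp only [a, b, hr]
  have hpend : ∑ k ∈ range m, (a k - b k) ^ 2 ≤ ∑ w, (x w + z w) ^ 2 := by
    rw [hsum fun s t => (s - t) ^ 2]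
    refine sum_le_sum fun w _ => ?_
    have h1 := neg_abs_le (x w * z w)
    rw [abs_mul] at h1
    nlinarith [sq_abs (x w), sq_abs (z w)]
  let φ : H.comap e ≃g H := Iso.comap e H
  have hform : (H.comap e).signlessForm (fun i => ((ε (e i) : ℤ) : ℝ) * a i) =
      H.signlessForm fun v => ((ε v : ℤ) : ℝ) * |x v| := by
    rw [← signlessForm_comp_iso φ]
    congr 1
    ext i
    simp only [a, hr]
    rfl
  have hbip : ¬ (H.comap e).IsBipartite := fun h => hH (Colorable.of_hom φ.symm.toHom h)
  have hcut' : ((H.comap e).cutGraph (ε ∘ e)).CrossesCuts := hcut.comap e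
  obtain ⟨h1, h2⟩ := lollipopForm_le_signlessForm hm hcut' hbip ha (abs_nonneg _)
  simp only [Function.comp_apply] at h1 h2
  rw [hform] at h1 h2
  refine ⟨a, b, ha, abs_nonneg _, fun k => abs_nonneg _, ?_, ?_, fun h3 h4 => ?_⟩
  · rw [hsum fun s t => s ^ 2 + t ^ 2]
    simp only [sq_abs]
  · rw [coronaForm]
    linarith
  · rw [coronaForm] at h3
    have h5 := h2 (by linarith) h4
    exact ⟨h5 ▸ φ.symm⟩

/-- If `u` and `v` were not adjacent, `{u, v}` and the third vertex would form a bipartition. -/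
theorem adj_of_card_eq_three (hW : Fintype.card W = 3) {H : SimpleGraph W}
    (hH : ¬ H.IsBipartite) {u v : W} (huv : u ≠ v) : H.Adj u v := by
  classical
  by_contra hadj
  refine hH ⟨Coloring.mk (fun w => if w = u ∨ w = v then (0 : Fin 2) else 1) fun {s t} hst => ?_⟩
  by_cases hs : s = u ∨ s = v <;> by_cases ht : t = u ∨ t = v
  · exfalso
    rcases hs with rfl | rfl <;> rcases ht with rfl | rfl
    exacts [hst.ne rfl, hadj hst, hadj hst.symm, hst.ne rfl]
  · simp [hs, ht]
  · simp [hs, ht]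
  · exfalso
    have h : ({u, v, s, t} : Finset W).card ≤ 3 := hW ▸ card_le_univ _
    rw [not_or] at hs ht
    rw [card_insert_of_notMem (by simp [huv, Ne.symm hs.1, Ne.symm ht.1]),
      card_insert_of_notMem (by simp [Ne.symm hs.2, Ne.symm ht.2]),
      card_insert_of_notMem (by simp [hst.ne]), card_singleton] at h
    omega

theorem nonempty_iso_lollipop_three (hW : Fintype.card W = 3) {H : SimpleGraph W}
    (hH : ¬ H.IsBipartite) : Nonempty (H ≃g lollipop 3 3) := by
  refine ⟨⟨Fintype.equivFinOfCardEq hW, fun {u v} => ?_⟩⟩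
  have h : ∀ i j : Fin 3, (lollipop 3 3).Adj i j ↔ i ≠ j := by decide
  rw [h, (Equiv.injective _).ne_iff]
  exact ⟨adj_of_card_eq_three hW hH, fun h => h.ne⟩

/-- Among the coronas of connected nonbipartite graphs of given order, that of the triangle with a
pendant path has the smallest least signless Laplacian eigenvalue, and it is the only one. -/
theorem qMin_corona [DecidableEq W] (hm : 3 ≤ m) (hW : Fintype.card W = m) {H : SimpleGraph W}
    [DecidableRel (H.corona (⊤ : SimpleGraph Unit)).Adj]
    (hcross : H.CrossesCuts) (hH : ¬ H.IsBipartite) :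
    (lollipopCorona m).qMin ≤ (H.corona (⊤ : SimpleGraph Unit)).qMin ∧
      ((H.corona (⊤ : SimpleGraph Unit)).qMin ≤ (lollipopCorona m).qMin →
        Nonempty (H ≃g lollipop 3 m)) := by
  have : Nonempty W := Fintype.card_pos_iff.1 (by omega)
  obtain ⟨y, hy0, hy⟩ := (H.corona (⊤ : SimpleGraph Unit)).exists_signlessForm_eq
  have hsq : ∑ v, y v ^ 2 = ∑ w, (y (.inl w) ^ 2 + y (.inr (w, ())) ^ 2) := by
    simp [Fintype.sum_sum_type, Fintype.sum_prod_type, sum_add_distrib]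
  have hpos : 0 < ∑ v, y v ^ 2 := by
    obtain ⟨v, hv⟩ := Function.ne_iff.1 hy0
    exact sum_pos' (fun _ _ => sq_nonneg _) ⟨v, mem_univ _, sq_pos_iff.2 hv⟩
  obtain ⟨a, b, ha, h0, hb, hnorm, hle, hrigid⟩ := exists_rearrangement hm hW hcross hH
    (fun w => y (.inl w)) fun w => y (.inr (w, ()))
  rw [← hsq] at hnorm
  rw [← signlessForm_corona, hy] at hle hrigid
  have hmin := qMin_lollipopCorona_mul_le hm
  have hab := hmin a b
  rw [hnorm] at hab
  refine ⟨le_of_mul_le_mul_right (hab.trans hle) hpos, fun hq => ?_⟩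
  have hq' := mul_le_mul_of_nonneg_right hq hpos.le
  rcases Nat.lt_or_ge m 4 with hm4 | hm4
  · obtain rfl : m = 3 := by omega
    exact nonempty_iso_lollipop_three hW hH
  · refine hrigid (hq'.trans hab) ?_
    refine (rigid_of_minimizer hm4 hmin ?_ ha h0 hb (hnorm ▸ hpos)).2
    rw [hnorm]
    exact le_antisymm (hle.trans hq') hab

end Corona

end SimpleGraph

theorem theorem5p2 {V : Type*} [Fintype V] [DecidableEq V] (G : SimpleGraph V)
    [DecidableRel G.Adj] (hconn : G.Connected) (hbip : ¬ G.IsBipartite)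
    (n : ℕ) (hcard : Fintype.card V = n) (hn : 6 ≤ n) (hdom : 2 * G.dominationNumber = n) :
    (SimpleGraph.lollipopCorona (n / 2)).qMin ≤ G.qMin ∧
      (G.qMin = (SimpleGraph.lollipopCorona (n / 2)).qMin ↔
        Nonempty (G ≃g SimpleGraph.lollipopCorona (n / 2))) := by
  classical
  obtain ⟨C, ⟨φ⟩⟩ := SimpleGraph.exists_iso_corona hconn (hdom.trans hcard.symm) (hcard ▸ hn)
  have hm : 3 ≤ n / 2 := by omega
  have hC : Fintype.card C = n / 2 := by
    have h := Fintype.card_congr φ.toEquiv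
    rw [hcard, Fintype.card_sum, Fintype.card_prod, Fintype.card_unit] at h
    omega
  have hcross : (G.induce C).CrossesCuts :=
    SimpleGraph.CrossesCuts.of_corona (φ.connected_iff.2 hconn).crossesCuts
  have hH : ¬ (G.induce C).IsBipartite := fun h =>
    hbip (SimpleGraph.Colorable.of_hom φ.symm.toHom h.corona)
  have : Nonempty V := Fintype.card_pos_iff.1 (by omega)
  have : Nonempty (C ⊕ C × Unit) := ⟨φ.symm (Classical.arbitrary V)⟩
  have : Nonempty (Fin (n / 2)) := ⟨⟨0, by omega⟩⟩
  have hq := SimpleGraph.qMin_eq_of_iso φ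
  obtain ⟨h1, h2⟩ := SimpleGraph.qMin_corona hm hC hcross hH
  rw [hq] at h1 h2
  refine ⟨h1, fun h => ?_, fun ⟨ψ⟩ => SimpleGraph.qMin_eq_of_iso ψ⟩
  obtain ⟨χ⟩ := h2 h.le
  exact ⟨φ.symm.trans (SimpleGraph.coronaIso χ)⟩
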